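/- Let $T,V,\lambda>0$, let $\mathbb T=\mathbb R/\mathbb Z$ be the one-dimensional torus, and let $\mathcal P(\mathbb T)$ and $\mathcal M(\mathbb T)$ denote the Borel probability measures and the finite signed Borel measures on $\mathbb T$, both with the narrow topology (duality with continuous functions). Let $(\rho_0,\omega_0)\in\mathcal P(\mathbb T)\times\mathcal M(\mathbb T)$ satisfy the bounded-speed condition $-V\rho_0\le\omega_0\le V\rho_0$. Then the one-dimensional Fourier–Cattaneo system $$\partial_t\rho=-\partial_x\omega,\qquad \partial_t\omega=-V^2\partial_x\rho-2\lambda\,\omega$$ has exactly one weak solution on $[0,T]$ with initial datum $(\rho_0,\omega_0)$. Here a weak solution is a pair of families $(\rho_t)_{t\in[0,T]}\subset\mathcal P(\mathbb T)$ and $(\omega_t)_{t\in[0,T]}\subset\mathcal M(\mathbb T)$ such that $\rho_t|_{t=0}=\rho_0$ and $\omega_t|_{t=0}=\omega_0$; $t\mapsto\rho_t$ is narrowly continuous on $[0,T]$ and $t\mapsto\omega_t$ is narrowly continuous on $(0,T)$; $(\lambda\omega_t)_{t\in(0,T)}$ is a measurable family with $\int_0^T\|\lambda\omega_t\|_{\mathrm{TV}}\,dt<\infty$;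 and for all $\varphi,\psi\in C^1(\mathbb T)$ and $0\le s\le t\le T$, $$\int_{\mathbb T}\varphi\,d\rho_t-\int_{\mathbb T}\varphi\,d\rho_s=\int_s^t\int_{\mathbb T}\partial_x\varphi\,d\omega_r\,dr,$$ $$\int_{\mathbb T}\psi\,d\omega_t-\int_{\mathbb T}\psi\,d\omega_s=V^2\int_s^t\int_{\mathbb T}\partial_x\psi\,d\rho_r\,dr-2\lambda\int_s^t\int_{\mathbb T}\psi\,d\omega_r\,dr.$$ Uniqueness means that any two such pairs agree for every $t\in[0,T]$. -/

import Mathlib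

open MeasureTheory MeasureTheory.VectorMeasure

namespace FourierCattaneo

/-- The one-dimensional torus `ℝ / ℤ`. -/
abbrev Torus : Type := UnitAddCircle

/-- `φ` belongs to `C¹(𝕋)` and its derivative `∂ₓφ` is the continuous function `φ'`: the
1-periodic lift of `φ` to `ℝ` is everywhere differentiable, with derivative the lift of `φ'`. -/
def HasTorusDeriv (φ φ' : C(Torus, ℝ)) : Prop :=
  ∀ x : ℝ, HasDerivAt (fun y : ℝ => φ (y : Torus)) (φ' (x : Torus)) x

/-- A curve of finite signed Borel measures is continuous on `s` for the narrow topology, i.e. the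
topology of duality with the (bounded) continuous functions. -/
def NarrowContinuousOn (ω : ℝ → SignedMeasure Torus) (s : Set ℝ) : Prop :=
  ∀ ψ : C(Torus, ℝ), ContinuousOn (fun t => ∫ᵛ x, ψ x ∂<•(ω t)) s

/-- The triple `(ρ, ω, K)` solves the momentum equation
`∂ₜρ + ∂ₓω = 0`, `∂ₜω + V² ∂ₓρ = -2 K` on `[0, T] × 𝕋`. Only the values of `ρ` and `ω` on `[0, T]`
and those of `K` on `(0, T)` matter. -/
structure IsMomentumSolution (T V : ℝ) (ρ : ℝ → ProbabilityMeasure Torus)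
    (ω K : ℝ → SignedMeasure Torus) : Prop where
  /-- `ρ ∈ C([0, T]; 𝒫(𝕋))`; `ProbabilityMeasure` carries the narrow topology. -/
  density_continuousOn : ContinuousOn ρ (Set.Icc 0 T)
  /-- `ω ∈ C((0, T); ℳ(𝕋))`. -/
  flux_continuousOn : NarrowContinuousOn ω (Set.Ioo 0 T)
  /-- `(K_t)` is a measurable family of signed measures on `(0, T)`. -/
  source_measurable : ∀ A : Set Torus, MeasurableSet A →
    Measurable (fun t : Set.Ioo (0 : ℝ) T => K t A)
  /-- `∫₀ᵀ ‖K_t‖_TV dt < ∞`. -/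
  source_integrable : ∫⁻ t in Set.Ioo 0 T, (K t).totalVariation Set.univ < ⊤
  /-- The time integrals of the flux in `density_eq` are meaningful. -/
  flux_integrable : ∀ φ φ' : C(Torus, ℝ), HasTorusDeriv φ φ' →
    IntervalIntegrable (fun r => ∫ᵛ x, φ' x ∂<•(ω r)) volume 0 T
  /-- The weak form of `∂ₜρ = -∂ₓω`. -/
  density_eq : ∀ φ φ' : C(Torus, ℝ), HasTorusDeriv φ φ' →
    ∀ s t : ℝ, 0 ≤ s → s ≤ t → t ≤ T →
      (∫ x, φ x ∂(ρ t : Measure Torus)) - (∫ x, φ x ∂(ρ s : Measure Torus))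
        = ∫ r in s..t, ∫ᵛ x, φ' x ∂<•(ω r)
  /-- The weak form of `∂ₜω = -V² ∂ₓρ - 2 K`. -/
  flux_eq : ∀ ψ ψ' : C(Torus, ℝ), HasTorusDeriv ψ ψ' →
    ∀ s t : ℝ, 0 ≤ s → s ≤ t → t ≤ T →
      (∫ᵛ x, ψ x ∂<•(ω t)) - (∫ᵛ x, ψ x ∂<•(ω s))
        = V ^ 2 * (∫ r in s..t, ∫ x, ψ' x ∂(ρ r : Measure Torus))
          - 2 * (∫ r in s..t, ∫ᵛ x, ψ x ∂<•(K r))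

/-- `(ρ, ω)` is a weak solution on `[0, T]` of the Fourier-Cattaneo system
`∂ₜρ = -∂ₓω`, `∂ₜω = -V² ∂ₓρ - 2 lam ω` with initial datum `(ρ₀, ω₀)`. -/
structure IsWeakSolution (T V lam : ℝ) (ρ₀ : ProbabilityMeasure Torus) (ω₀ : SignedMeasure Torus)
    (ρ : ℝ → ProbabilityMeasure Torus) (ω : ℝ → SignedMeasure Torus) : Prop where
  momentum : IsMomentumSolution T V ρ ω (fun t => lam • ω t)
  density_zero : ρ 0 = ρ₀
  flux_zero : ω 0 = ω₀

end FourierCattaneo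

/-! Existence. The Riemann invariants `a = (Vρ + ω)/2` and `b = (Vρ - ω)/2` diagonalise the
transport part: `a` moves with velocity `V`, `b` with velocity `-V`, and they exchange mass at rate
`lam`. The bounded-speed condition says exactly that both start as positive measures. On test
functions, removing the transport and the factor `exp (-lam t)` leaves only the gain term, so the
solution is a Dyson series. Its terms are nonnegative on nonnegative functions when `t ≥ 0`, and it
is dominated by an exponential series. Riesz–Markov turns its sum into measures
(`exists_riemannInvariants`). Then `ρ = (a + b)/V` and `ω = a - b` solve the system, with total mass
conserved.

Uniqueness. Testing the difference of two solutions with a Fourier mode for `ρ` and the conjugate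
mode for `ω` gives a closed pair of scalar equations, a damped oscillator. Its energy `V² p² + q²`
starts at zero and cannot increase (`oscillator_eq_zero`). Hence all Fourier coefficients agree, and
these determine the measures. -/

namespace FourierCattaneo

open Filter Topology

/-! ### Translations acting on test functions -/

/-- Translation of a continuous function on the torus. -/
noncomputable def translate (a : ℝ) (f : C(Torus, ℝ)) : C(Torus, ℝ) :=
  f.comp ⟨fun x => x + (a : Torus), by fun_prop⟩

@[simp] lemma translate_apply (a : ℝ) (f : C(Torus, ℝ)) (x : Torus) :
    translate a f x = f (x + (a : Torus)) := rfl

lemma translate_translate (a b : ℝ) (f : C(Torus, ℝ)) :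
    translate a (translate b f) = translate (a + b) f := by
  ext x
  simp [add_assoc]

lemma translate_add (a : ℝ) (f g : C(Torus, ℝ)) :
    translate a (f + g) = translate a f + translate a g := rfl

lemma translate_smul (a r : ℝ) (f : C(Torus, ℝ)) :
    translate a (r • f) = r • translate a f := rfl

lemma norm_translate_le (a : ℝ) (f : C(Torus, ℝ)) : ‖translate a f‖ ≤ ‖f‖ :=
  (ContinuousMap.norm_le _ (norm_nonneg f)).2 fun x => f.norm_coe_le_norm (x + (a : Torus))

lemma translate_nonneg (a : ℝ) {f : C(Torus, ℝ)} (hf : 0 ≤ f) : 0 ≤ translate a f :=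
  fun x => hf (x + (a : Torus))

lemma continuous_translate : Continuous fun p : ℝ × C(Torus, ℝ) => translate p.1 p.2 := by
  let shift : C(ℝ, C(Torus, Torus)) :=
    ContinuousMap.curry ⟨fun q : ℝ × Torus => q.2 + (q.1 : Torus), by fun_prop⟩
  have h : Continuous fun p : ℝ × C(Torus, ℝ) => p.2.comp (shift p.1) :=
    continuous_snd.compCM (shift.continuous.comp continuous_fst)
  exact h

@[fun_prop]
lemma _root_.Continuous.translate {X : Type*} [TopologicalSpace X] {a : X → ℝ}
    {f : X → C(Torus, ℝ)} (ha : Continuous a) (hf : Continuous f) :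
    Continuous fun x => FourierCattaneo.translate (a x) (f x) :=
  continuous_translate.comp (ha.prodMk hf)

/-! ### The Dyson series -/

/-- Terms of the Dyson series, in the interaction picture, of the telegraph process that moves with
velocity `c` and switches to velocity `-c` at rate `lam`. -/
noncomputable def dysonTerm (lam : ℝ) (F₀ : ℝ → C(Torus, ℝ) →L[ℝ] ℝ) :
    ℕ → ℝ → ℝ → C(Torus, ℝ) → ℝ
  | 0, c, _, g => F₀ c g
  -- In the picture of velocity `c`, `g` stands for the test function `translate (-(c * s)) g` at
  -- time `s`. Passing to the picture of velocity `-c` shifts by `-(c * s)` once more, hence the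
  -- factor 2.
  | n + 1, c, t, g => ∫ s in (0 : ℝ)..t,
      lam * dysonTerm lam F₀ n (-c) s (translate (-(2 * c * s)) g)

section Dyson

variable {lam C : ℝ} {F₀ : ℝ → C(Torus, ℝ) →L[ℝ] ℝ}

/-- Joint continuity is needed because the test function moves with the integration variable in the
next term; the induction keeps `c` general because its sign flips. -/
lemma continuous_dysonTerm (n : ℕ) (c : ℝ) :
    Continuous fun p : ℝ × C(Torus, ℝ) => dysonTerm lam F₀ n c p.1 p.2 := by
  induction n generalizing c with
  | zero => exact (F₀ c).continuous.comp continuous_snd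
  | succ n ih =>
    refine intervalIntegral.continuous_parametric_intervalIntegral_of_continuous
      (f := fun (p : ℝ × C(Torus, ℝ)) s =>
        lam * dysonTerm lam F₀ n (-c) s (translate (-(2 * c * s)) p.2)) ?_ continuous_fst
    have h : Continuous fun q : (ℝ × C(Torus, ℝ)) × ℝ =>
        (q.2, translate (-(2 * c * q.2)) q.1.2) := by fun_prop
    exact continuous_const.mul ((ih (-c)).comp h)

lemma continuous_interaction (c : ℝ) (g : C(Torus, ℝ)) :
    Continuous fun s : ℝ => (s, translate (-(2 * c * s)) g) := by fun_prop

lemma continuous_dysonTerm_integrand (n : ℕ) (c : ℝ) (g : C(Torus, ℝ)) :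
    Continuous fun s => lam * dysonTerm lam F₀ n (-c) s (translate (-(2 * c * s)) g) :=
  continuous_const.mul ((continuous_dysonTerm n (-c)).comp (continuous_interaction c g))

lemma dysonTerm_add (n : ℕ) (c t : ℝ) (f g : C(Torus, ℝ)) :
    dysonTerm lam F₀ n c t (f + g) = dysonTerm lam F₀ n c t f + dysonTerm lam F₀ n c t g := by
  induction n generalizing c t f g with
  | zero => exact map_add _ _ _
  | succ n ih =>
    simp only [dysonTerm, translate_add, ih, mul_add]
    exact intervalIntegral.integral_add
      ((continuous_dysonTerm_integrand n c f).intervalIntegrable _ _)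
      ((continuous_dysonTerm_integrand n c g).intervalIntegrable _ _)

lemma dysonTerm_smul (n : ℕ) (c t r : ℝ) (f : C(Torus, ℝ)) :
    dysonTerm lam F₀ n c t (r • f) = r * dysonTerm lam F₀ n c t f := by
  induction n generalizing c t f with
  | zero => exact map_smul _ _ _
  | succ n ih =>
    simp only [dysonTerm, translate_smul, ih, mul_left_comm lam r]
    exact intervalIntegral.integral_const_mul _ _

lemma dysonTerm_nonneg (hlam : 0 ≤ lam) (hF : ∀ c g, 0 ≤ g → 0 ≤ F₀ c g) (n : ℕ) (c : ℝ) {t : ℝ}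
    (ht : 0 ≤ t) {g : C(Torus, ℝ)} (hg : 0 ≤ g) : 0 ≤ dysonTerm lam F₀ n c t g := by
  induction n generalizing c t g with
  | zero => exact hF c g hg
  | succ n ih =>
    exact intervalIntegral.integral_nonneg ht fun s hs =>
      mul_nonneg hlam (ih (-c) hs.1 (translate_nonneg _ hg))

/-- Translations do not increase the norm, so only the nested time integrals count; they produce the
factorial. -/
lemma abs_dysonTerm_le (hlam : 0 ≤ lam) (hC : ∀ c, ‖F₀ c‖ ≤ C) (n : ℕ) (c t : ℝ)
    (g : C(Torus, ℝ)) :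
    |dysonTerm lam F₀ n c t g| ≤ (lam * |t|) ^ n / n.factorial * (C * ‖g‖) := by
  have hC0 : 0 ≤ C := (norm_nonneg (F₀ 0)).trans (hC 0)
  induction n generalizing c t g with
  | zero => simpa [dysonTerm] using (F₀ c).le_of_opNorm_le (hC c) g
  | succ n ih =>
    calc |dysonTerm lam F₀ (n + 1) c t g|
        ≤ ∫ s in Set.uIoc 0 t, |lam * dysonTerm lam F₀ n (-c) s (translate (-(2 * c * s)) g)| := by
          simp only [dysonTerm, ← Real.norm_eq_abs]
          exact intervalIntegral.norm_integral_le_integral_norm_uIoc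
      _ ≤ ∫ s in Set.uIoc 0 t, lam ^ (n + 1) / n.factorial * (C * ‖g‖) * |s - 0| ^ n := by
          refine integral_mono ?_ ?_ fun s => ?_
          · exact ((continuous_dysonTerm_integrand n c g).abs.integrableOn_uIoc)
          · exact Continuous.integrableOn_uIoc (by fun_prop)
          · dsimp only
            rw [abs_mul, abs_of_nonneg hlam]
            have h1 := ih (-c) s (translate (-(2 * c * s)) g)
            have h2 : (lam * |s|) ^ n / n.factorial * (C * ‖translate (-(2 * c * s)) g‖)
                ≤ (lam * |s|) ^ n / n.factorial * (C * ‖g‖) := by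
              gcongr
              exact norm_translate_le _ g
            calc _ ≤ lam * ((lam * |s|) ^ n / n.factorial * (C * ‖g‖)) := by
                  gcongr
                  exact h1.trans h2
              _ = _ := by rw [sub_zero]; ring
      _ = _ := by
          rw [integral_const_mul, integral_pow_abs_sub_uIoc, Nat.factorial_succ]
          push_cast
          rw [sub_zero, mul_pow]
          field_simp

/-- The sum of the Dyson series. -/
noncomputable def dysonSum (lam : ℝ) (F₀ : ℝ → C(Torus, ℝ) →L[ℝ] ℝ) (c t : ℝ)
    (g : C(Torus, ℝ)) : ℝ :=
  ∑' n, dysonTerm lam F₀ n c t g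

lemma summable_dysonBound (r D : ℝ) : Summable fun n : ℕ => r ^ n / n.factorial * D :=
  (Real.summable_pow_div_factorial r).mul_right D

lemma summable_dysonTerm (hlam : 0 ≤ lam) (hC : ∀ c, ‖F₀ c‖ ≤ C) (c t : ℝ) (g : C(Torus, ℝ)) :
    Summable fun n => dysonTerm lam F₀ n c t g :=
  .of_norm_bounded (summable_dysonBound (lam * |t|) (C * ‖g‖))
    fun n => abs_dysonTerm_le hlam hC n c t g

lemma dysonSum_add (hlam : 0 ≤ lam) (hC : ∀ c, ‖F₀ c‖ ≤ C) (c t : ℝ) (f g : C(Torus, ℝ)) :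
    dysonSum lam F₀ c t (f + g) = dysonSum lam F₀ c t f + dysonSum lam F₀ c t g := by
  simp only [dysonSum, dysonTerm_add]
  exact (summable_dysonTerm hlam hC c t f).tsum_add (summable_dysonTerm hlam hC c t g)

lemma dysonSum_smul (c t r : ℝ) (f : C(Torus, ℝ)) :
    dysonSum lam F₀ c t (r • f) = r * dysonSum lam F₀ c t f := by
  simp only [dysonSum, dysonTerm_smul]
  exact tsum_mul_left

lemma dysonSum_nonneg (hlam : 0 ≤ lam) (hF : ∀ c g, 0 ≤ g → 0 ≤ F₀ c g) (c : ℝ) {t : ℝ}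
    (ht : 0 ≤ t) {g : C(Torus, ℝ)} (hg : 0 ≤ g) : 0 ≤ dysonSum lam F₀ c t g :=
  tsum_nonneg fun n => dysonTerm_nonneg hlam hF n c ht hg

lemma abs_dysonTerm_le_of_le (hlam : 0 ≤ lam) (hC : ∀ c, ‖F₀ c‖ ≤ C) (n : ℕ) (c : ℝ) {t R K : ℝ}
    {g : C(Torus, ℝ)} (ht : |t| ≤ R) (hg : ‖g‖ ≤ K) :
    |dysonTerm lam F₀ n c t g| ≤ (lam * R) ^ n / n.factorial * (C * K) := by
  have hC0 : 0 ≤ C := (norm_nonneg (F₀ 0)).trans (hC 0)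
  have hR : 0 ≤ R := (abs_nonneg t).trans ht
  refine (abs_dysonTerm_le hlam hC n c t g).trans ?_
  gcongr

lemma continuous_dysonSum (hlam : 0 ≤ lam) (hC : ∀ c, ‖F₀ c‖ ≤ C) (c : ℝ) :
    Continuous fun p : ℝ × C(Torus, ℝ) => dysonSum lam F₀ c p.1 p.2 := by
  rw [continuous_iff_continuousAt]
  intro p
  -- The dominating series depends on bounds for `t` and `‖g‖`, so the M-test is applied on a
  -- bounded neighbourhood.
  have hs : {q : ℝ × C(Torus, ℝ) | |q.1| < |p.1| + 1 ∧ ‖q.2‖ < ‖p.2‖ + 1} ∈ 𝓝 p := by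
    refine IsOpen.mem_nhds ?_ ⟨by linarith, by linarith⟩
    exact (isOpen_lt continuous_fst.abs continuous_const).inter
      (isOpen_lt continuous_snd.norm continuous_const)
  refine ContinuousOn.continuousAt (continuousOn_tsum
    (fun n => (continuous_dysonTerm n c).continuousOn)
    (summable_dysonBound (lam * (|p.1| + 1)) (C * (‖p.2‖ + 1))) ?_) hs
  exact fun n q hq => abs_dysonTerm_le_of_le hlam hC n c hq.1.le hq.2.le

/-- Splitting off the term `n = 0` and summing the recursion under the integral gives this Duhamel
equation. -/
lemma dysonSum_eq (hlam : 0 ≤ lam) (hC : ∀ c, ‖F₀ c‖ ≤ C) (c t : ℝ) (g : C(Torus, ℝ)) :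
    dysonSum lam F₀ c t g = F₀ c g
      + ∫ s in (0 : ℝ)..t, lam * dysonSum lam F₀ (-c) s (translate (-(2 * c * s)) g) := by
  have h := intervalIntegral.hasSum_integral_of_dominated_convergence (μ := volume) (a := 0) (b := t)
    (F := fun n s => lam * dysonTerm lam F₀ n (-c) s (translate (-(2 * c * s)) g))
    (f := fun s => lam * dysonSum lam F₀ (-c) s (translate (-(2 * c * s)) g))
    (fun n _ => lam * ((lam * |t|) ^ n / n.factorial * (C * ‖g‖)))
    (fun n => (continuous_dysonTerm_integrand n c g).aestronglyMeasurable)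
    (fun n => Eventually.of_forall fun s hs => ?_)
    (Eventually.of_forall fun s _ => (summable_dysonBound _ _).mul_left lam)
    intervalIntegrable_const
    (Eventually.of_forall fun s _ => (summable_dysonTerm hlam hC _ _ _).hasSum.mul_left lam)
  · rw [dysonSum, (summable_dysonTerm hlam hC c t g).tsum_eq_zero_add]
    exact congrArg _ h.tsum_eq
  · rw [norm_mul, Real.norm_of_nonneg hlam]
    gcongr
    refine abs_dysonTerm_le_of_le hlam hC n _ ?_ (norm_translate_le _ g)
    rw [Set.uIoc_eq_union] at hs
    rcases hs with hs | hs
    · rw [abs_of_pos hs.1, abs_of_pos (hs.1.trans_le hs.2)]; exact hs.2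
    · rw [abs_of_nonpos hs.2, abs_of_neg (hs.1.trans_le hs.2)]; linarith [hs.1]

lemma hasDerivAt_dysonSum (hlam : 0 ≤ lam) (hC : ∀ c, ‖F₀ c‖ ≤ C) (c t : ℝ) (g : C(Torus, ℝ)) :
    HasDerivAt (fun t => dysonSum lam F₀ c t g)
      (lam * dysonSum lam F₀ (-c) t (translate (-(2 * c * t)) g)) t := by
  have hcont : Continuous fun s => lam * dysonSum lam F₀ (-c) s (translate (-(2 * c * s)) g) :=
    continuous_const.mul ((continuous_dysonSum hlam hC (-c)).comp (continuous_interaction c g))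
  exact ((hcont.integral_hasStrictDerivAt 0 t).hasDerivAt.const_add (F₀ c g)).congr_of_eventuallyEq
    (Eventually.of_forall fun t => dysonSum_eq hlam hC c t g)

lemma dysonSum_sub (hlam : 0 ≤ lam) (hC : ∀ c, ‖F₀ c‖ ≤ C) (c t : ℝ) (f g : C(Torus, ℝ)) :
    dysonSum lam F₀ c t (f - g) = dysonSum lam F₀ c t f - dysonSum lam F₀ c t g := by
  have h := dysonSum_add hlam hC c t (f - g) g
  rw [sub_add_cancel] at h
  linarith

/-- By linearity the slope splits into `dysonSum` at time `s` of the slope of `G`, plus the slope in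
time at the fixed function `G t`. Joint continuity gives the limit of the first part. -/
lemma hasDerivAt_dysonSum_comp (hlam : 0 ≤ lam) (hC : ∀ c, ‖F₀ c‖ ≤ C) (c t : ℝ)
    {G : ℝ → C(Torus, ℝ)} {G' : C(Torus, ℝ)} (hG : HasDerivAt G G' t) :
    HasDerivAt (fun s => dysonSum lam F₀ c s (G s))
      (dysonSum lam F₀ c t G' + lam * dysonSum lam F₀ (-c) t (translate (-(2 * c * t)) (G t))) t := by
  have h1 := hasDerivAt_iff_tendsto_slope.1 (hasDerivAt_dysonSum hlam hC c t (G t))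
  have h2 := hasDerivAt_iff_tendsto_slope.1 hG
  rw [hasDerivAt_iff_tendsto_slope]
  have h3 : Tendsto (fun s => dysonSum lam F₀ c s (slope G t s)) (𝓝[≠] t)
      (𝓝 (dysonSum lam F₀ c t G')) :=
    ((continuous_dysonSum hlam hC c).tendsto (t, G')).comp
      ((tendsto_nhdsWithin_of_tendsto_nhds tendsto_id).prodMk_nhds h2)
  refine (h3.add h1).congr fun s => ?_
  simp only [slope_def_module, dysonSum_smul, dysonSum_sub hlam hC, smul_eq_mul]
  ring

end Dyson

/-! ### Derivatives of translations; measures as functionals on `C(Torus, ℝ)` -/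

/-- The integral is taken in `C(Torus, ℝ)`, so differentiating it yields a derivative in the sup
norm, although the identity is checked pointwise. -/
lemma HasTorusDeriv.translate_eq {f f' : C(Torus, ℝ)} (hf : HasTorusDeriv f f') (c t : ℝ) :
    translate (c * t) f = f + ∫ s in (0 : ℝ)..t, c • translate (c * s) f' := by
  have hcont : Continuous fun s : ℝ => c • translate (c * s) f' := by fun_prop
  ext x
  obtain ⟨x, rfl⟩ := QuotientAddGroup.mk_surjective x
  have hev : (∫ s in (0 : ℝ)..t, c • translate (c * s) f') (x : Torus)
      = ∫ s in (0 : ℝ)..t, c * f' ((x + c * s : ℝ) : Torus) := by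
    have := (ContinuousMap.evalCLM ℝ (x : Torus)).intervalIntegral_comp_comm
      (hcont.intervalIntegrable (μ := volume) 0 t)
    simpa using this.symm
  have hd : ∀ s : ℝ, HasDerivAt (fun s : ℝ => f ((x + c * s : ℝ) : Torus))
      (c * f' ((x + c * s : ℝ) : Torus)) s := fun s => by
    have h := (hf (x + c * s)).comp s (((hasDerivAt_id s).const_mul c).const_add x)
    simpa [mul_comm, Function.comp_def] using h
  have hftc := intervalIntegral.integral_eq_sub_of_hasDerivAt (a := 0) (b := t)
    (fun s _ => hd s) (Continuous.intervalIntegrable (by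
      have : Continuous fun s : ℝ => ((x + c * s : ℝ) : Torus) :=
        (AddCircle.continuous_mk' 1).comp (by fun_prop)
      fun_prop) _ _)
  change f ((x : Torus) + ((c * t : ℝ) : Torus)) = f (x : Torus) + _
  erw [hev, hftc]
  simp

lemma HasTorusDeriv.hasDerivAt_translate {f f' : C(Torus, ℝ)} (hf : HasTorusDeriv f f')
    (c t : ℝ) : HasDerivAt (fun t : ℝ => translate (c * t) f) (c • translate (c * t) f') t := by
  have hcont : Continuous fun s : ℝ => c • translate (c * s) f' := by fun_prop
  simp_rw [fun t => hf.translate_eq c t]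
  exact (hcont.integral_hasStrictDerivAt 0 t).hasDerivAt.const_add f

/-- A positive linear functional on `C(𝕋)` is integration against a finite measure. -/
lemma exists_finiteMeasure_integral_eq (Λ : C(Torus, ℝ) →ₗ[ℝ] ℝ) (hΛ : ∀ f, 0 ≤ f → 0 ≤ Λ f) :
    ∃ μ : FiniteMeasure Torus, ∀ f : C(Torus, ℝ), ∫ x, f x ∂(μ : Measure Torus) = Λ f := by
  let L : CompactlySupportedContinuousMap Torus ℝ →ₗ[ℝ] ℝ :=
    { toFun := fun f => Λ (f : C(Torus, ℝ))
      map_add' := fun f g => Λ.map_add _ _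
      map_smul' := fun r f => Λ.map_smul _ _ }
  let P : CompactlySupportedContinuousMap Torus ℝ →ₚ[ℝ] ℝ :=
    PositiveLinearMap.mk₀ L fun f hf => hΛ _ hf
  have hfin : IsFiniteMeasure (RealRMK.rieszMeasure P) :=
    ⟨(isCompact_univ (X := Torus)).measure_lt_top⟩
  refine ⟨⟨RealRMK.rieszMeasure P, hfin⟩, fun f => ?_⟩
  exact RealRMK.integral_rieszMeasure P (CompactlySupportedContinuousMap.continuousMapEquiv f)

lemma integrable_continuousMap (f : C(Torus, ℝ)) (μ : Measure Torus) [IsFiniteMeasure μ] :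
    Integrable f μ :=
  f.continuous.integrable_of_hasCompactSupport (HasCompactSupport.of_compactSpace f)

/-- Integration against a finite measure, as a continuous functional on `C(𝕋)`. -/
noncomputable def integralCLM (μ : Measure Torus) [IsFiniteMeasure μ] : C(Torus, ℝ) →L[ℝ] ℝ :=
  LinearMap.mkContinuous
    { toFun := fun f => ∫ x, f x ∂μ
      map_add' := fun f g =>
        integral_add (integrable_continuousMap f μ) (integrable_continuousMap g μ)
      map_smul' := fun r f => integral_const_mul r _ } (μ.real Set.univ) fun f => by
    rw [mul_comm]
    exact norm_integral_le_of_norm_le_const (Eventually.of_forall f.norm_coe_le_norm)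

lemma integralCLM_apply (μ : Measure Torus) [IsFiniteMeasure μ] (f : C(Torus, ℝ)) :
    integralCLM μ f = ∫ x, f x ∂μ := rfl

lemma finiteMeasure_ext {μ ν : Measure Torus} [IsFiniteMeasure μ] [IsFiniteMeasure ν]
    (h : ∀ f : C(Torus, ℝ), ∫ x, f x ∂μ = ∫ x, f x ∂ν) : μ = ν :=
  ext_of_forall_integral_eq_of_IsFiniteMeasure fun f => h f.toContinuousMap

/-! ### The telegraph process and the Riemann invariants -/

/-- The distribution at time `t` of the part of the telegraph process that moves with velocity `c`,
as a functional on `C(𝕋)`. -/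
noncomputable def telegraph (lam : ℝ) (F₀ : ℝ → C(Torus, ℝ) →L[ℝ] ℝ) (c t : ℝ)
    (f : C(Torus, ℝ)) : ℝ :=
  Real.exp (-(lam * t)) * dysonSum lam F₀ c t (translate (c * t) f)

section Telegraph

variable {lam C : ℝ} {F₀ : ℝ → C(Torus, ℝ) →L[ℝ] ℝ}

lemma continuous_telegraph (hlam : 0 ≤ lam) (hC : ∀ c, ‖F₀ c‖ ≤ C) (c : ℝ) (f : C(Torus, ℝ)) :
    Continuous fun t => telegraph lam F₀ c t f := by
  have h : Continuous fun t : ℝ => (t, translate (c * t) f) := by fun_prop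
  exact (by fun_prop : Continuous fun t => Real.exp (-(lam * t))).mul
    ((continuous_dysonSum hlam hC c).comp h)

lemma telegraph_zero (hlam : 0 ≤ lam) (hC : ∀ c, ‖F₀ c‖ ≤ C) (c : ℝ) (f : C(Torus, ℝ)) :
    telegraph lam F₀ c 0 f = F₀ c f := by
  have h : translate 0 f = f := by ext x; simp
  rw [telegraph, dysonSum_eq hlam hC]
  simp [h]

lemma hasDerivAt_telegraph (hlam : 0 ≤ lam) (hC : ∀ c, ‖F₀ c‖ ≤ C) (c t : ℝ)
    {f f' : C(Torus, ℝ)} (hf : HasTorusDeriv f f') :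
    HasDerivAt (fun t => telegraph lam F₀ c t f)
      (c * telegraph lam F₀ c t f' - lam * telegraph lam F₀ c t f
        + lam * telegraph lam F₀ (-c) t f) t := by
  have h1 := hasDerivAt_dysonSum_comp hlam hC c t (hf.hasDerivAt_translate c t)
  have h2 : HasDerivAt (fun t => Real.exp (-(lam * t))) (Real.exp (-(lam * t)) * -lam) t := by
    simpa using (((hasDerivAt_id t).const_mul lam).neg).exp
  refine (h2.mul h1).congr_deriv ?_
  rw [dysonSum_smul, translate_translate, show -(2 * c * t) + c * t = -c * t by ring]
  simp only [telegraph]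
  ring

lemma exists_finiteMeasure_telegraph (hlam : 0 ≤ lam) (hC : ∀ c, ‖F₀ c‖ ≤ C)
    (hF : ∀ c g, 0 ≤ g → 0 ≤ F₀ c g) (c : ℝ) {t : ℝ} (ht : 0 ≤ t) :
    ∃ μ : FiniteMeasure Torus, ∀ f : C(Torus, ℝ),
      ∫ x, f x ∂(μ : Measure Torus) = telegraph lam F₀ c t f :=
  exists_finiteMeasure_integral_eq
    { toFun := telegraph lam F₀ c t
      map_add' := fun f g => by
        simp only [telegraph, translate_add, dysonSum_add hlam hC, mul_add]
      map_smul' := fun r f => by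
        simp only [telegraph, translate_smul, dysonSum_smul, smul_eq_mul, RingHom.id_apply]
        ring }
    fun f hf => mul_nonneg (Real.exp_pos _).le
      (dysonSum_nonneg hlam hF c ht (translate_nonneg _ hf))

end Telegraph

/-- Existence for the system `∂ₜa = -V ∂ₓa - lam (a - b)`, `∂ₜb = V ∂ₓb + lam (a - b)`, solved by the
Riemann invariants of the Fourier-Cattaneo system. -/
lemma exists_riemannInvariants {lam V : ℝ} (hlam : 0 ≤ lam) (hV : 0 < V) (μ ν : Measure Torus)
    [IsFiniteMeasure μ] [IsFiniteMeasure ν] :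
    ∃ a b : ℝ → FiniteMeasure Torus,
      (a 0 : Measure Torus) = μ ∧ (b 0 : Measure Torus) = ν ∧
      (∀ f : C(Torus, ℝ), Continuous fun t => ∫ x, f x ∂(a t : Measure Torus)) ∧
      (∀ f : C(Torus, ℝ), Continuous fun t => ∫ x, f x ∂(b t : Measure Torus)) ∧
      (∀ f f' : C(Torus, ℝ), HasTorusDeriv f f' → ∀ t, 0 < t →
        HasDerivAt (fun t => ∫ x, f x ∂(a t : Measure Torus))
          (V * ∫ x, f' x ∂(a t : Measure Torus) - lam * ∫ x, f x ∂(a t : Measure Torus)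
            + lam * ∫ x, f x ∂(b t : Measure Torus)) t) ∧
      (∀ f f' : C(Torus, ℝ), HasTorusDeriv f f' → ∀ t, 0 < t →
        HasDerivAt (fun t => ∫ x, f x ∂(b t : Measure Torus))
          (-V * ∫ x, f' x ∂(b t : Measure Torus) - lam * ∫ x, f x ∂(b t : Measure Torus)
            + lam * ∫ x, f x ∂(a t : Measure Torus)) t) := by
  -- Only the velocities `V` and `-V` matter, and they differ since `V > 0`.
  let F₀ : ℝ → C(Torus, ℝ) →L[ℝ] ℝ := fun c => if c = V then integralCLM μ else integralCLM ν
  have hF₀V : F₀ V = integralCLM μ := if_pos rfl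
  have hF₀V' : F₀ (-V) = integralCLM ν := if_neg (by linarith)
  have hC : ∀ c, ‖F₀ c‖ ≤ max ‖integralCLM μ‖ ‖integralCLM ν‖ := fun c => by
    by_cases h : c = V <;> simp [F₀, h]
  have hF : ∀ c g, 0 ≤ g → 0 ≤ F₀ c g := fun c g hg => by
    by_cases h : c = V <;> simp only [F₀, h, if_true, if_false] <;>
      exact integral_nonneg fun x => hg x
  -- Positivity is available only for nonnegative times; the curves are frozen at their initial
  -- value before 0, so derivatives are claimed only for `t > 0`.
  have key : ∀ c t, ∃ m : FiniteMeasure Torus, ∀ f : C(Torus, ℝ),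
      ∫ x, f x ∂(m : Measure Torus) = telegraph lam F₀ c (max t 0) f :=
    fun c t => exists_finiteMeasure_telegraph hlam hC hF c (le_max_right t 0)
  choose m hm using key
  have hderiv : ∀ c (f f' : C(Torus, ℝ)), HasTorusDeriv f f' → ∀ t, 0 < t →
      HasDerivAt (fun t => ∫ x, f x ∂(m c t : Measure Torus))
        (c * ∫ x, f' x ∂(m c t : Measure Torus) - lam * ∫ x, f x ∂(m c t : Measure Torus)
          + lam * ∫ x, f x ∂(m (-c) t : Measure Torus)) t := fun c f f' hf t ht => by
    simp only [hm, max_eq_left ht.le]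
    refine (hasDerivAt_telegraph hlam hC c t hf).congr_of_eventuallyEq ?_
    filter_upwards [lt_mem_nhds ht] with s hs
    rw [max_eq_left hs.le]
  have hcont : ∀ c (f : C(Torus, ℝ)), Continuous fun t => ∫ x, f x ∂(m c t : Measure Torus) :=
    fun c f => by
      simp only [hm]
      exact (continuous_telegraph hlam hC c f).comp (continuous_id.max continuous_const)
  refine ⟨m V, m (-V), ?_, ?_, hcont V, hcont (-V), hderiv V, ?_⟩
  · refine finiteMeasure_ext fun f => ?_
    rw [hm, max_self, telegraph_zero hlam hC, hF₀V, integralCLM_apply]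
  · refine finiteMeasure_ext fun f => ?_
    rw [hm, max_self, telegraph_zero hlam hC, hF₀V', integralCLM_apply]
  · simpa only [neg_neg] using hderiv (-V)

/-! ### Existence of a weak solution -/

/-- Indicators of closed sets are limits of continuous functions, and closed sets form a π-system
generating the Borel sets. -/
lemma measurable_of_continuous_integral {a : ℝ → FiniteMeasure Torus}
    (ha : ∀ f : C(Torus, ℝ), Continuous fun t => ∫ x, f x ∂(a t : Measure Torus)) :
    Measurable fun t => (a t : Measure Torus) := by
  have hclosed : ∀ s : Set Torus, IsClosed s → Measurable fun t => (a t : Measure Torus) s := by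
    intro s hs
    refine measurable_of_tendsto_metrizable
      (f := fun n t => ∫⁻ x, hs.apprSeq n x ∂(a t : Measure Torus)) (fun n => ?_)
      (tendsto_pi_nhds.2 fun t => HasOuterApproxClosed.tendsto_lintegral_apprSeq hs _)
    let g : C(Torus, ℝ) := ⟨fun x => (hs.apprSeq n x : ℝ), by fun_prop⟩
    have h : ∀ t, ∫⁻ x, hs.apprSeq n x ∂(a t : Measure Torus)
        = ENNReal.ofReal (∫ x, g x ∂(a t : Measure Torus)) := fun t => by
      rw [ofReal_integral_eq_lintegral_ofReal (integrable_continuousMap g _)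
        (Eventually.of_forall fun x => (hs.apprSeq n x).coe_nonneg)]
      simp [g]
    simp only [h]
    exact (ha g).measurable.ennreal_ofReal
  exact .measure_of_isPiSystem
    (by rw [BorelSpace.measurable_eq (α := Torus), borel_eq_generateFrom_isClosed])
    isPiSystem_isClosed hclosed (hclosed _ isClosed_univ)

lemma hasTorusDeriv_const (r : ℝ) : HasTorusDeriv (ContinuousMap.const _ r) 0 :=
  fun x => hasDerivAt_const x r

instance isFiniteMeasure_variation {X : Type*} [MeasurableSpace X] (s : SignedMeasure X) :
    IsFiniteMeasure s.variation := by
  rw [← s.totalVariation_eq_variation, SignedMeasure.totalVariation]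
  infer_instance

lemma integrable_signedMeasure (f : C(Torus, ℝ)) (s : SignedMeasure Torus) :
    s.Integrable f :=
  integrable_continuousMap f _

lemma integral_toSignedMeasure_sub (f : C(Torus, ℝ)) (μ ν : Measure Torus) [IsFiniteMeasure μ]
    [IsFiniteMeasure ν] :
    ∫ᵛ x, f x ∂<•(μ.toSignedMeasure - ν.toSignedMeasure) = ∫ x, f x ∂μ - ∫ x, f x ∂ν := by
  rw [integral_sub_vectorMeasure (integrable_signedMeasure f _) (integrable_signedMeasure f _),
    integral_toSignedMeasure, integral_toSignedMeasure]

lemma hasDerivAt_of_pos_sub_eq_integral {p p' : ℝ → ℝ} (hp : Continuous p) (hp' : Continuous p')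
    (h : ∀ t, 0 < t → HasDerivAt p (p' t) t) {s t : ℝ} (hs : 0 ≤ s) (hst : s ≤ t) :
    p t - p s = ∫ r in s..t, p' r :=
  (intervalIntegral.integral_eq_sub_of_hasDerivAt_of_le hst hp.continuousOn
    (fun r hr => h r (hs.trans_lt hr.1)) (hp'.intervalIntegrable _ _)).symm

/-- Under the bounded-speed condition the initial Riemann invariants are positive measures. -/
lemma exists_initial_riemannInvariants {V : ℝ} {ρ₀ : ProbabilityMeasure Torus}
    {ω₀ : SignedMeasure Torus} (h_lower : -(V • (ρ₀ : Measure Torus).toSignedMeasure) ≤ ω₀)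
    (h_upper : ω₀ ≤ V • (ρ₀ : Measure Torus).toSignedMeasure) :
    ∃ μ ν : FiniteMeasure Torus,
      (μ : Measure Torus).toSignedMeasure + (ν : Measure Torus).toSignedMeasure
        = V • (ρ₀ : Measure Torus).toSignedMeasure ∧
      (μ : Measure Torus).toSignedMeasure - (ν : Measure Torus).toSignedMeasure = ω₀ := by
  have key : ∀ s : SignedMeasure Torus, 0 ≤ s →
      ∃ μ : FiniteMeasure Torus, (μ : Measure Torus).toSignedMeasure = s := fun s hs =>
    ⟨⟨s.toMeasureOfZeroLE Set.univ MeasurableSet.univ ((le_restrict_univ_iff_le _ _).2 hs),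
      inferInstance⟩, s.toMeasureOfZeroLE_toSignedMeasure _⟩
  obtain ⟨μ, hμ⟩ := key ((2⁻¹ : ℝ) • (V • (ρ₀ : Measure Torus).toSignedMeasure + ω₀))
    fun i hi => by
      have := h_lower i hi
      simp only [FunLike.coe_neg, FunLike.coe_smul, FunLike.coe_add, FunLike.coe_zero, Pi.zero_apply,
        Pi.neg_apply, Pi.smul_apply, Pi.add_apply, smul_eq_mul] at this ⊢
      linarith
  obtain ⟨ν, hν⟩ := key ((2⁻¹ : ℝ) • (V • (ρ₀ : Measure Torus).toSignedMeasure - ω₀))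
    fun i hi => by
      have := h_upper i hi
      simp only [FunLike.coe_sub, FunLike.coe_smul, FunLike.coe_zero, Pi.zero_apply,
        Pi.sub_apply, Pi.smul_apply, smul_eq_mul] at this ⊢
      linarith
  refine ⟨μ, ν, ?_, ?_⟩ <;> rw [hμ, hν] <;> module

/-- Existence of a weak solution of the Fourier-Cattaneo system. -/
theorem exists_isWeakSolution (T : ℝ) {V lam : ℝ} (hV : 0 < V) (hlam : 0 ≤ lam)
    (ρ₀ : ProbabilityMeasure Torus) (ω₀ : SignedMeasure Torus)
    (h_lower : -(V • (ρ₀ : Measure Torus).toSignedMeasure) ≤ ω₀)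
    (h_upper : ω₀ ≤ V • (ρ₀ : Measure Torus).toSignedMeasure) :
    ∃ ρ ω, IsWeakSolution T V lam ρ₀ ω₀ ρ ω := by
  obtain ⟨μ, ν, hadd, hsub⟩ := exists_initial_riemannInvariants h_lower h_upper
  obtain ⟨a, b, ha0, hb0, ha, hb, hda, hdb⟩ :=
    exists_riemannInvariants hlam hV (μ : Measure Torus) (ν : Measure Torus)
  have hadd_int : ∀ f : C(Torus, ℝ), ∫ x, f x ∂(μ : Measure Torus) + ∫ x, f x ∂(ν : Measure Torus)
      = V * ∫ x, f x ∂(ρ₀ : Measure Torus) := fun f => by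
    have h := congrArg (fun s : SignedMeasure Torus => ∫ᵛ x, f x ∂<•s) hadd
    simpa [integral_add_vectorMeasure (integrable_signedMeasure f _)
      (integrable_signedMeasure f _)] using h
  -- Testing with the constant 1 kills the transport terms, and the exchange terms cancel in the
  -- sum.
  have hmass : ∀ t, 0 ≤ t →
      (a t : Measure Torus).real Set.univ + (b t : Measure Torus).real Set.univ = V := by
    intro t ht
    have h := hasDerivAt_of_pos_sub_eq_integral (p' := fun _ => 0)
      ((ha (ContinuousMap.const _ 1)).add (hb (ContinuousMap.const _ 1))) continuous_const
      (fun t ht => ((hda _ _ (hasTorusDeriv_const 1) t ht).add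
        (hdb _ _ (hasTorusDeriv_const 1) t ht)).congr_deriv (by simp)) le_rfl ht
    have h0 := hadd_int (ContinuousMap.const _ 1)
    simp only [Pi.add_apply, ContinuousMap.const_apply, MeasureTheory.integral_const,
      smul_eq_mul, mul_one, intervalIntegral.integral_zero, ha0, hb0, probReal_univ] at h h0
    linarith
  let m : ℝ → Measure Torus := fun t =>
    Real.toNNReal V⁻¹ • ((a (max t 0) : Measure Torus) + (b (max t 0) : Measure Torus))
  have hm : ∀ t, IsProbabilityMeasure (m t) := fun t => by
    rw [isProbabilityMeasure_iff_real, measureReal_nnreal_smul_apply, measureReal_add_apply,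
      hmass _ (le_max_right t 0), Real.coe_toNNReal _ (inv_nonneg.2 hV.le), inv_mul_cancel₀ hV.ne']
  let ρ : ℝ → ProbabilityMeasure Torus := fun t => ⟨m t, hm t⟩
  let ω : ℝ → SignedMeasure Torus := fun t =>
    (a t : Measure Torus).toSignedMeasure - (b t : Measure Torus).toSignedMeasure
  have hρ' : ∀ t (f : C(Torus, ℝ)), ∫ x, f x ∂(ρ t : Measure Torus)
      = V⁻¹ * (∫ x, f x ∂(a (max t 0) : Measure Torus)
        + ∫ x, f x ∂(b (max t 0) : Measure Torus)) := fun t f => by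
    change ∫ x, f x ∂(m t) = _
    rw [integral_smul_nnreal_measure, integral_add_measure (integrable_continuousMap f _)
      (integrable_continuousMap f _), NNReal.smul_def, Real.coe_toNNReal _ (inv_nonneg.2 hV.le),
      smul_eq_mul]
  have hρ : ∀ t, 0 ≤ t → ∀ f : C(Torus, ℝ), ∫ x, f x ∂(ρ t : Measure Torus)
      = V⁻¹ * (∫ x, f x ∂(a t : Measure Torus) + ∫ x, f x ∂(b t : Measure Torus)) :=
    fun t ht f => by rw [hρ', max_eq_left ht]
  have hω : ∀ t (f : C(Torus, ℝ)), ∫ᵛ x, f x ∂<•(ω t)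
      = ∫ x, f x ∂(a t : Measure Torus) - ∫ x, f x ∂(b t : Measure Torus) :=
    fun t f => integral_toSignedMeasure_sub f _ _
  have hρc : ∀ f : C(Torus, ℝ), Continuous fun t => ∫ x, f x ∂(ρ t : Measure Torus) := fun f => by
    simp only [hρ']
    exact continuous_const.mul (((ha f).add (hb f)).comp (continuous_id.max continuous_const))
  have hωc : ∀ f : C(Torus, ℝ), Continuous fun t => ∫ᵛ x, f x ∂<•(ω t) := fun f => by
    simp only [hω]
    exact (ha f).sub (hb f)
  refine ⟨ρ, ω, ⟨?_, ?_, ?_, ?_, ?_, ?_, ?_⟩, ?_, ?_⟩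
  · refine (continuous_iff_continuousAt.2 fun t => ?_).continuousOn
    exact ProbabilityMeasure.tendsto_iff_forall_integral_tendsto.2 fun f =>
      (hρc f.toContinuousMap).tendsto t
  · exact fun f => (hωc f).continuousOn
  · intro A hA
    have hreal : ∀ c : ℝ → FiniteMeasure Torus,
        (∀ f : C(Torus, ℝ), Continuous fun t => ∫ x, f x ∂(c t : Measure Torus)) →
        Measurable fun t => (c t : Measure Torus).real A := fun c hc =>
      ((Measure.measurable_coe hA).comp (measurable_of_continuous_integral hc)).ennreal_toReal
    have h : ∀ t, (lam • ω t) A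
        = lam * ((a t : Measure Torus).real A - (b t : Measure Torus).real A) := fun t => by
      rw [smul_apply, Measure.toSignedMeasure_sub_apply hA, smul_eq_mul]
    simp only [h]
    exact (((hreal a ha).sub (hreal b hb)).const_mul lam).comp measurable_subtype_coe
  · have hbound : ∀ t ∈ Set.Ioo 0 T, (lam • ω t).totalVariation Set.univ
        ≤ ENNReal.ofReal (lam * V) := fun t ht => by
      rw [SignedMeasure.totalVariation_eq_variation, variation_smul,
        Measure.smul_apply, ENNReal.smul_def, smul_eq_mul,
        ENNReal.ofReal_mul hlam, Real.nnnorm_of_nonneg hlam]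
      -- The variation of `a - b` is at most the total mass of `a + b`, which is `V`.
      have h1 : (ω t).variation Set.univ ≤ ENNReal.ofReal V := by
        rw [← hmass t ht.1.le, ENNReal.ofReal_add measureReal_nonneg measureReal_nonneg,
          ofReal_measureReal, ofReal_measureReal]
        simpa using variation_sub_le (μ := (a t : Measure Torus).toSignedMeasure)
          (ν := (b t : Measure Torus).toSignedMeasure) Set.univ
      gcongr
      exact (ENNReal.ofReal_eq_coe_nnreal hlam).ge
    refine (setLIntegral_mono measurable_const hbound).trans_lt ?_
    rw [setLIntegral_const]
    exact ENNReal.mul_lt_top ENNReal.ofReal_lt_top (by simp)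
  · exact fun _ f' _ => (hωc f').intervalIntegrable _ _
  · intro f f' hf s t hs hst _
    rw [hρ t (hs.trans hst), hρ s hs]
    refine hasDerivAt_of_pos_sub_eq_integral
      (p := fun t => V⁻¹ * (∫ x, f x ∂(a t : Measure Torus) + ∫ x, f x ∂(b t : Measure Torus)))
      (continuous_const.mul ((ha f).add (hb f))) (hωc f') (fun r hr => ?_) hs hst
    refine (((hda f f' hf r hr).add (hdb f f' hf r hr)).const_mul V⁻¹).congr_deriv ?_
    rw [hω]
    field_simp
    ring
  · intro f f' hf s t hs hst _
    simp only [integral_smul_vectorMeasure, smul_eq_mul]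
    rw [← intervalIntegral.integral_const_mul, ← intervalIntegral.integral_const_mul,
      ← intervalIntegral.integral_sub (((hρc f').const_mul _).intervalIntegrable _ _)
        ((((hωc f).const_mul _).const_mul _).intervalIntegrable _ _)]
    refine hasDerivAt_of_pos_sub_eq_integral (hωc f)
      (p' := fun r => V ^ 2 * ∫ x, f' x ∂(ρ r : Measure Torus) - 2 * (lam * ∫ᵛ x, f x ∂<•(ω r)))
      (((hρc f').const_mul _).sub (((hωc f).const_mul _).const_mul _)) (fun r hr => ?_) hs hst
    simp only [hω, hρ r hr.le]
    refine ((hda f f' hf r hr).sub (hdb f f' hf r hr)).congr_deriv ?_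
    field_simp
    ring
  · refine Subtype.ext (show (ρ 0 : Measure Torus) = (ρ₀ : Measure Torus) from
      finiteMeasure_ext fun f => ?_)
    rw [hρ 0 le_rfl, ha0, hb0, hadd_int, inv_mul_cancel_left₀ hV.ne']
  · rw [← hsub]
    simp only [ω]
    congr 1 <;> exact Measure.toSignedMeasure_congr ‹_›

/-! ### Fourier modes determine measures -/

/-- The function `x ↦ cos (2πnx)` on the torus. -/
noncomputable def cosMode (n : ℤ) : C(Torus, ℝ) := ⟨fun x => (fourier n x).re, by fun_prop⟩

/-- The function `x ↦ sin (2πnx)` on the torus. -/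
noncomputable def sinMode (n : ℤ) : C(Torus, ℝ) := ⟨fun x => (fourier n x).im, by fun_prop⟩

lemma fourier_eq_exp (n : ℤ) (x : ℝ) :
    fourier n (x : Torus) = Complex.exp ((2 * Real.pi * n * x : ℝ) * Complex.I) := by
  rw [fourier_coe_apply]
  congr 1
  push_cast
  ring

lemma cosMode_apply (n : ℤ) (x : ℝ) : cosMode n (x : Torus) = Real.cos (2 * Real.pi * n * x) := by
  change (fourier n (x : Torus)).re = _
  rw [fourier_eq_exp, Complex.exp_ofReal_mul_I_re]

lemma sinMode_apply (n : ℤ) (x : ℝ) : sinMode n (x : Torus) = Real.sin (2 * Real.pi * n * x) := by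
  change (fourier n (x : Torus)).im = _
  rw [fourier_eq_exp, Complex.exp_ofReal_mul_I_im]

lemma hasTorusDeriv_cosMode (n : ℤ) :
    HasTorusDeriv (cosMode n) ((-(2 * Real.pi * n)) • sinMode n) := fun x => by
  simp only [cosMode_apply, ContinuousMap.smul_apply, sinMode_apply, smul_eq_mul]
  refine (((hasDerivAt_id x).const_mul (2 * Real.pi * n)).cos).congr_deriv ?_
  simp only [id]
  ring

lemma hasTorusDeriv_sinMode (n : ℤ) :
    HasTorusDeriv (sinMode n) ((2 * Real.pi * n) • cosMode n) := fun x => by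
  simp only [cosMode_apply, ContinuousMap.smul_apply, sinMode_apply, smul_eq_mul]
  refine (((hasDerivAt_id x).const_mul (2 * Real.pi * n)).sin).congr_deriv ?_
  simp only [id]
  ring

/-- Finite measures on the torus are determined by their Fourier coefficients. -/
lemma measure_ext_of_modes {μ ν : Measure Torus} [IsFiniteMeasure μ] [IsFiniteMeasure ν]
    (hcos : ∀ n, ∫ x, cosMode n x ∂μ = ∫ x, cosMode n x ∂ν)
    (hsin : ∀ n, ∫ x, sinMode n x ∂μ = ∫ x, sinMode n x ∂ν) : μ = ν := by
  -- Trigonometric polynomials, viewed as bounded continuous functions: a point-separating star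
  -- subalgebra.
  let A : StarSubalgebra ℂ (BoundedContinuousFunction Torus ℂ) :=
    (@fourierSubalgebra 1).comap (BoundedContinuousFunction.toContinuousMapStarₐ ℂ)
  have hint : ∀ (g : C(Torus, ℂ)) (m : Measure Torus) [IsFiniteMeasure m], Integrable g m :=
    fun g m _ => g.continuous.integrable_of_hasCompactSupport (HasCompactSupport.of_compactSpace g)
  have hmem : ∀ g ∈ Submodule.span ℂ (Set.range (@fourier 1)), ∫ x, g x ∂μ = ∫ x, g x ∂ν := by
    intro g hg
    induction hg using Submodule.span_induction with
    | mem g hg =>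
      obtain ⟨n, rfl⟩ := hg
      have h : ∀ (m : Measure Torus) [IsFiniteMeasure m], ∫ x, fourier n x ∂m
          = ((∫ x, cosMode n x ∂m : ℝ) : ℂ) + ((∫ x, sinMode n x ∂m : ℝ) : ℂ) * Complex.I :=
        fun m _ => (integral_re_add_im (𝕜 := ℂ) (hint (fourier n) m)).symm
      rw [h μ, h ν, hcos, hsin]
    | zero => simp
    | add f g _ _ ihf ihg =>
      simp only [ContinuousMap.add_apply]
      rw [MeasureTheory.integral_add (hint f μ) (hint g μ),
        MeasureTheory.integral_add (hint f ν) (hint g ν), ihf, ihg]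
    | smul r f _ ih =>
      simp only [ContinuousMap.smul_apply]
      rw [MeasureTheory.integral_smul, MeasureTheory.integral_smul, ih]
  refine ext_of_forall_mem_subalgebra_integral_eq_of_polish (𝕜 := ℂ) (A := A) ?_
    fun g hg => hmem g.toContinuousMap ?_
  swap
  · rw [← fourierSubalgebra_coe]
    exact hg
  intro x y hxy
  obtain ⟨_, ⟨f, hf, rfl⟩, hne⟩ := fourierSubalgebra_separatesPoints hxy
  exact ⟨f, ⟨f, ⟨BoundedContinuousFunction.mkOfCompact f, hf, rfl⟩, rfl⟩, hne⟩

/-- Finite signed measures on the torus are determined by their Fourier coefficients. -/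
lemma signedMeasure_ext_of_modes {s t : SignedMeasure Torus}
    (hcos : ∀ n, ∫ᵛ x, cosMode n x ∂<•s = ∫ᵛ x, cosMode n x ∂<•t)
    (hsin : ∀ n, ∫ᵛ x, sinMode n x ∂<•s = ∫ᵛ x, sinMode n x ∂<•t) : s = t := by
  have hdec : ∀ s : SignedMeasure Torus, s.toJordanDecomposition.posPart.toSignedMeasure
      - s.toJordanDecomposition.negPart.toSignedMeasure = s :=
    fun s => s.toSignedMeasure_toJordanDecomposition
  have hint : ∀ (f : C(Torus, ℝ)) (s : SignedMeasure Torus), ∫ᵛ x, f x ∂<•s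
      = ∫ x, f x ∂s.toJordanDecomposition.posPart
        - ∫ x, f x ∂s.toJordanDecomposition.negPart := fun f s => by
    rw [← integral_toSignedMeasure_sub, hdec]
  -- Moving the negative Jordan parts across the equality reduces the claim to positive measures.
  have key : ∀ f : C(Torus, ℝ), ∫ᵛ x, f x ∂<•s = ∫ᵛ x, f x ∂<•t →
      ∫ x, f x ∂(s.toJordanDecomposition.posPart + t.toJordanDecomposition.negPart)
        = ∫ x, f x ∂(t.toJordanDecomposition.posPart + s.toJordanDecomposition.negPart) := by
    intro f h
    rw [hint, hint] at h
    rw [integral_add_measure (integrable_continuousMap f _) (integrable_continuousMap f _),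
      integral_add_measure (integrable_continuousMap f _) (integrable_continuousMap f _)]
    linarith
  have h := Measure.toSignedMeasure_congr
    (measure_ext_of_modes (fun n => key _ (hcos n)) (fun n => key _ (hsin n)))
  rw [Measure.toSignedMeasure_add, Measure.toSignedMeasure_add] at h
  rw [← hdec s, ← hdec t, sub_eq_sub_iff_add_eq_add, h]

/-! ### Uniqueness by the energy of each mode -/

/-- The damped harmonic oscillator, in integral form, has no nonzero solution with zero initial
datum, because its energy decreases. -/
lemma oscillator_eq_zero {T V lam κ : ℝ} (hV : 0 < V) (hlam : 0 ≤ lam) {p q : ℝ → ℝ}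
    (hq : IntervalIntegrable q volume 0 T)
    (hp_eq : ∀ t ∈ Set.Icc 0 T, p t = κ * ∫ r in (0 : ℝ)..t, q r)
    (hq_eq : ∀ t ∈ Set.Icc 0 T,
      q t = V ^ 2 * (-κ * ∫ r in (0 : ℝ)..t, p r) - 2 * (lam * ∫ r in (0 : ℝ)..t, q r)) :
    ∀ t ∈ Set.Icc 0 T, p t = 0 ∧ q t = 0 := by
  intro t ht
  have hT : 0 ≤ T := ht.1.trans ht.2
  have hprim : ∀ {g : ℝ → ℝ}, IntervalIntegrable g volume 0 T →
      ContinuousOn (fun t => ∫ r in (0 : ℝ)..t, g r) (Set.Icc 0 T) := fun hg => by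
    rw [← Set.uIcc_of_le hT]
    exact intervalIntegral.continuousOn_primitive_interval' hg Set.left_mem_uIcc
  -- Bootstrap: integrability of `q` makes `p` continuous, and then the second equation makes `q`
  -- continuous up to the endpoints.
  have hpc : ContinuousOn p (Set.Icc 0 T) :=
    ((hprim hq).const_smul κ).congr hp_eq
  have hp : IntervalIntegrable p volume 0 T := hpc.intervalIntegrable_of_Icc hT
  have hqc : ContinuousOn q (Set.Icc 0 T) :=
    ((((hprim hp).const_smul (-κ)).const_smul (V ^ 2)).sub
      (((hprim hq).const_smul lam).const_smul (2 : ℝ))).congr hq_eq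
  have hderiv : ∀ {g : ℝ → ℝ}, ContinuousOn g (Set.Icc 0 T) → ∀ t ∈ Set.Ioo 0 T,
      HasDerivAt (fun t => ∫ r in (0 : ℝ)..t, g r) (g t) t := fun {g} hg t ht =>
    intervalIntegral.integral_hasDerivAt_right
      ((hg.mono (Set.Icc_subset_Icc_right ht.2.le)).intervalIntegrable_of_Icc ht.1.le)
      ((hg.mono Set.Ioo_subset_Icc_self).stronglyMeasurableAtFilter isOpen_Ioo t ht)
      (hg.continuousAt (Icc_mem_nhds ht.1 ht.2))
  -- The weight `V ^ 2` makes the cross terms in `κ * p * q` cancel, leaving only damping.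
  have hE : ∀ t ∈ Set.Ioo 0 T, HasDerivAt (fun t => V ^ 2 * p t ^ 2 + q t ^ 2)
      (-(4 * lam * q t ^ 2)) t := fun t ht => by
    have hev : ∀ᶠ s in 𝓝 t, s ∈ Set.Icc 0 T := Icc_mem_nhds ht.1 ht.2
    have hdp : HasDerivAt p (κ * q t) t :=
      ((hderiv hqc t ht).const_mul κ).congr_of_eventuallyEq (hev.mono hp_eq)
    have hdq : HasDerivAt q (V ^ 2 * (-κ * p t) - 2 * (lam * q t)) t :=
      ((((hderiv hpc t ht).const_mul (-κ)).const_mul (V ^ 2)).sub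
        (((hderiv hqc t ht).const_mul lam).const_mul 2)).congr_of_eventuallyEq (hev.mono hq_eq)
    refine (((hdp.pow 2).const_mul (V ^ 2)).add (hdq.pow 2)).congr_deriv ?_
    simp
    ring
  have hanti : AntitoneOn (fun t => V ^ 2 * p t ^ 2 + q t ^ 2) (Set.Icc 0 T) := by
    refine antitoneOn_of_deriv_nonpos (convex_Icc 0 T) (by fun_prop) ?_ ?_ <;> rw [interior_Icc]
    · exact fun t ht => (hE t ht).differentiableAt.differentiableWithinAt
    · intro t ht
      rw [(hE t ht).deriv]
      have := mul_nonneg hlam (sq_nonneg (q t))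
      linarith
  have h0 : (0 : ℝ) ∈ Set.Icc 0 T := ⟨le_rfl, hT⟩
  have hle := hanti h0 ht ht.1
  have hp0 : p 0 = 0 := by simp [hp_eq 0 h0]
  have hq0 : q 0 = 0 := by simp [hq_eq 0 h0]
  simp only [hp0, hq0] at hle
  have h1 := mul_nonneg (sq_nonneg V) (sq_nonneg (p t))
  have h2 := sq_nonneg (q t)
  have h3 : V ^ 2 * p t ^ 2 = 0 := by linarith
  have h4 : q t ^ 2 = 0 := by linarith
  exact ⟨pow_eq_zero_iff two_ne_zero |>.1 ((mul_eq_zero.1 h3).resolve_left (by positivity)),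
    pow_eq_zero_iff two_ne_zero |>.1 h4⟩

section Uniqueness

variable {T V lam : ℝ} {ρ₀ : ProbabilityMeasure Torus} {ω₀ : SignedMeasure Torus}
  {ρ ρ' : ℝ → ProbabilityMeasure Torus} {ω ω' : ℝ → SignedMeasure Torus}

/-- This covers the zero mode: the constant 1 is not a derivative on the torus, so `flux_integrable`
does not apply. Integrability comes from the source `lam • ω` instead, divided by `lam ≠ 0`. -/
lemma IsWeakSolution.intervalIntegrable_flux_univ (hT : 0 ≤ T) (hlam : 0 < lam)
    (h : IsWeakSolution T V lam ρ₀ ω₀ ρ ω) :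
    IntervalIntegrable (fun r => ω r Set.univ) volume 0 T := by
  have hK : IntegrableOn (fun r => (lam • ω r) Set.univ) (Set.Ioo 0 T) := by
    refine ⟨AEMeasurable.aestronglyMeasurable ?_, ?_⟩
    · rw [aemeasurable_restrict_iff_comap_subtype measurableSet_Ioo]
      exact (h.momentum.source_measurable _ MeasurableSet.univ).aemeasurable
    · exact (lintegral_mono fun r => SignedMeasure.enorm_le_totalVariation _ _).trans_lt
        h.momentum.source_integrable
  rw [intervalIntegrable_iff_integrableOn_Ioo_of_le hT]
  refine (hK.const_mul lam⁻¹).congr (Eventually.of_forall fun r => ?_)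
  simp only [smul_apply, smul_eq_mul]
  exact inv_mul_cancel_left₀ hlam.ne' _

lemma IsWeakSolution.intervalIntegrable_of_hasTorusDeriv (h : IsWeakSolution T V lam ρ₀ ω₀ ρ ω)
    {φ ψ : C(Torus, ℝ)} {κ : ℝ} (hκ : κ ≠ 0) (hφ : HasTorusDeriv φ (κ • ψ)) :
    IntervalIntegrable (fun r => ∫ᵛ x, ψ x ∂<•(ω r)) volume 0 T := by
  refine ((h.momentum.flux_integrable φ _ hφ).const_mul κ⁻¹).congr
    (fun r _ => ?_)
  simp only [ContinuousMap.smul_apply]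
  rw [integral_fun_smul, smul_eq_mul, inv_mul_cancel_left₀ hκ]

lemma IsWeakSolution.intervalIntegrable_cosMode (hT : 0 ≤ T) (hlam : 0 < lam)
    (h : IsWeakSolution T V lam ρ₀ ω₀ ρ ω) (n : ℤ) :
    IntervalIntegrable (fun r => ∫ᵛ x, cosMode n x ∂<•(ω r)) volume 0 T := by
  rcases eq_or_ne n 0 with rfl | hn
  · have h1 : ∀ x, cosMode 0 x = 1 := fun x => by simp [cosMode]
    simpa [h1] using h.intervalIntegrable_flux_univ hT hlam
  · exact h.intervalIntegrable_of_hasTorusDeriv (by positivity) (hasTorusDeriv_sinMode n)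

lemma IsWeakSolution.intervalIntegrable_sinMode
    (h : IsWeakSolution T V lam ρ₀ ω₀ ρ ω) (n : ℤ) :
    IntervalIntegrable (fun r => ∫ᵛ x, sinMode n x ∂<•(ω r)) volume 0 T := by
  rcases eq_or_ne n 0 with rfl | hn
  · have h1 : ∀ x, sinMode 0 x = 0 := fun x => by simp [sinMode]
    simp [h1]
  · exact h.intervalIntegrable_of_hasTorusDeriv (neg_ne_zero.2 (by positivity))
      (hasTorusDeriv_cosMode n)

lemma IsWeakSolution.continuousOn_integral (h : IsWeakSolution T V lam ρ₀ ω₀ ρ ω)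
    (f : C(Torus, ℝ)) :
    ContinuousOn (fun t => ∫ x, f x ∂(ρ t : Measure Torus)) (Set.Icc 0 T) := fun t ht =>
  ProbabilityMeasure.tendsto_iff_forall_integral_tendsto.1 (h.momentum.density_continuousOn t ht)
    (BoundedContinuousFunction.mkOfCompact f)

/-- The conditions `φ' = κ ψ` and `ψ' = -κ φ` close the two weak equations on a single pair of
coefficients. A cosine and a sine of equal frequency, in either order, form such a pair. -/
lemma IsWeakSolution.integral_eq_of_hasTorusDeriv (hV : 0 < V) (hlam : 0 ≤ lam)
    (h : IsWeakSolution T V lam ρ₀ ω₀ ρ ω) (h' : IsWeakSolution T V lam ρ₀ ω₀ ρ' ω')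
    {φ ψ : C(Torus, ℝ)} {κ : ℝ} (hφ : HasTorusDeriv φ (κ • ψ)) (hψ : HasTorusDeriv ψ (-κ • φ))
    (hi : IntervalIntegrable (fun r => ∫ᵛ x, ψ x ∂<•(ω r)) volume 0 T)
    (hi' : IntervalIntegrable (fun r => ∫ᵛ x, ψ x ∂<•(ω' r)) volume 0 T)
    {t : ℝ} (ht : t ∈ Set.Icc 0 T) :
    ∫ x, φ x ∂(ρ' t : Measure Torus) = ∫ x, φ x ∂(ρ t : Measure Torus) ∧
      ∫ᵛ x, ψ x ∂<•(ω' t) = ∫ᵛ x, ψ x ∂<•(ω t) := by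
  have hsub : ∀ s ∈ Set.Icc 0 T, Set.uIcc 0 s ⊆ Set.uIcc 0 T := fun s hs => by
    rw [Set.uIcc_of_le hs.1, Set.uIcc_of_le (hs.1.trans hs.2)]
    exact Set.Icc_subset_Icc_right hs.2
  have hρi : ∀ {ρ ω}, IsWeakSolution T V lam ρ₀ ω₀ ρ ω → ∀ s ∈ Set.Icc 0 T,
      IntervalIntegrable (fun r => ∫ x, φ x ∂(ρ r : Measure Torus)) volume 0 s := fun h s hs =>
    ((h.continuousOn_integral φ).mono (Set.Icc_subset_Icc_right hs.2)).intervalIntegrable_of_Icc hs.1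
  have hρ : ∀ {ρ ω}, IsWeakSolution T V lam ρ₀ ω₀ ρ ω → ∀ s ∈ Set.Icc 0 T,
      ∫ x, φ x ∂(ρ s : Measure Torus) - ∫ x, φ x ∂(ρ₀ : Measure Torus)
        = κ * ∫ r in (0 : ℝ)..s, ∫ᵛ x, ψ x ∂<•(ω r) := fun {ρ ω} h s hs => by
    have e := h.momentum.density_eq φ _ hφ 0 s le_rfl hs.1 hs.2
    have hmul : ∀ s : SignedMeasure Torus, ∫ᵛ x, (κ • ψ) x ∂<•s = κ * ∫ᵛ x, ψ x ∂<•s :=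
      fun s => integral_fun_smul s _ κ ψ
    simpa only [h.density_zero, hmul, intervalIntegral.integral_const_mul] using e
  have hω : ∀ {ρ ω}, IsWeakSolution T V lam ρ₀ ω₀ ρ ω → ∀ s ∈ Set.Icc 0 T,
      ∫ᵛ x, ψ x ∂<•(ω s) - ∫ᵛ x, ψ x ∂<•ω₀
        = V ^ 2 * (-κ * ∫ r in (0 : ℝ)..s, ∫ x, φ x ∂(ρ r : Measure Torus))
          - 2 * (lam * ∫ r in (0 : ℝ)..s, ∫ᵛ x, ψ x ∂<•(ω r)) := fun {ρ ω} h s hs => by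
    have e := h.momentum.flux_eq ψ _ hψ 0 s le_rfl hs.1 hs.2
    simpa only [h.flux_zero, ContinuousMap.smul_apply, integral_smul_vectorMeasure,
      MeasureTheory.integral_const_mul, smul_eq_mul, intervalIntegral.integral_const_mul] using e
  have key := oscillator_eq_zero (κ := κ) hV hlam
    (p := fun t => ∫ x, φ x ∂(ρ' t : Measure Torus) - ∫ x, φ x ∂(ρ t : Measure Torus))
    (q := fun t => ∫ᵛ x, ψ x ∂<•(ω' t) - ∫ᵛ x, ψ x ∂<•(ω t)) (hi'.sub hi)
    (fun s hs => by
      rw [intervalIntegral.integral_sub (hi'.mono_set (hsub s hs)) (hi.mono_set (hsub s hs))]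
      linarith [hρ h s hs, hρ h' s hs])
    (fun s hs => by
      rw [intervalIntegral.integral_sub (hi'.mono_set (hsub s hs)) (hi.mono_set (hsub s hs)),
        intervalIntegral.integral_sub (hρi h' s hs) (hρi h s hs)]
      linarith [hω h s hs, hω h' s hs]) t ht
  exact ⟨sub_eq_zero.1 key.1, sub_eq_zero.1 key.2⟩

/-- Uniqueness of weak solutions of the Fourier-Cattaneo system. -/
theorem IsWeakSolution.unique (hV : 0 < V) (hlam : 0 < lam)
    (h : IsWeakSolution T V lam ρ₀ ω₀ ρ ω) (h' : IsWeakSolution T V lam ρ₀ ω₀ ρ' ω')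
    {t : ℝ} (ht : t ∈ Set.Icc 0 T) : ρ' t = ρ t ∧ ω' t = ω t := by
  have hT : 0 ≤ T := ht.1.trans ht.2
  have hcos := fun n => h.integral_eq_of_hasTorusDeriv hV hlam.le h' (hasTorusDeriv_cosMode n)
    (by simpa using hasTorusDeriv_sinMode n) (h.intervalIntegrable_sinMode n)
    (h'.intervalIntegrable_sinMode n) ht
  have hsin := fun n => h.integral_eq_of_hasTorusDeriv hV hlam.le h' (hasTorusDeriv_sinMode n)
    (hasTorusDeriv_cosMode n) (h.intervalIntegrable_cosMode hT hlam n)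
    (h'.intervalIntegrable_cosMode hT hlam n) ht
  exact ⟨Subtype.ext (show (ρ' t : Measure Torus) = (ρ t : Measure Torus) from
      measure_ext_of_modes (fun n => (hcos n).1) fun n => (hsin n).1),
    signedMeasure_ext_of_modes (fun n => (hsin n).2) fun n => (hcos n).2⟩

end Uniqueness

end FourierCattaneo

theorem theorem2p7 (T V lam : ℝ) (hT : 0 < T) (hV : 0 < V) (hlam : 0 < lam)
    (ρ₀ : ProbabilityMeasure FourierCattaneo.Torus)
    (ω₀ : SignedMeasure FourierCattaneo.Torus)
    (h_lower : -(V • (ρ₀ : Measure FourierCattaneo.Torus).toSignedMeasure) ≤ ω₀)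
    (h_upper : ω₀ ≤ V • (ρ₀ : Measure FourierCattaneo.Torus).toSignedMeasure) :
    ∃ (ρ : ℝ → ProbabilityMeasure FourierCattaneo.Torus)
      (ω : ℝ → SignedMeasure FourierCattaneo.Torus),
      FourierCattaneo.IsWeakSolution T V lam ρ₀ ω₀ ρ ω ∧
      ∀ (ρ' : ℝ → ProbabilityMeasure FourierCattaneo.Torus)
        (ω' : ℝ → SignedMeasure FourierCattaneo.Torus),
        FourierCattaneo.IsWeakSolution T V lam ρ₀ ω₀ ρ' ω' →
        ∀ t ∈ Set.Icc 0 T, ρ' t = ρ t ∧ ω' t = ω t := by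
  obtain ⟨ρ, ω, h⟩ :=
    FourierCattaneo.exists_isWeakSolution T hV hlam.le ρ₀ ω₀ h_lower h_upper
  exact ⟨ρ, ω, h, fun ρ' ω' h' t ht => h.unique hV hlam h' ht⟩
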